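/- Let $\ell:[0,\infty)\to[0,\infty)$ be a nondecreasing function with $\ell(0)=0$ and $\ell\not\equiv 0$. Let $n,M,T,s$ be integers with $n\ge 1$, $M\ge 2$, $T\ge 1$ and $1\le s\le M/2$. Consider the multi-task regression model $$y_t = X_t\beta^*_t + W_t,\qquad t=1,\dots,T,$$ where each $X_t$ is a deterministic $n\times M$ matrix, $\beta^*_t\in\mathbb R^M$, and the $nT$ components of the noise $W=(W_1,\dots,W_T)$ are i.i.d. $\mathcal N(0,\sigma^2)$ with $\sigma>0$. Stacking the tasks, write $y=X\beta^*+W\in\mathbb R^{nT}$ with $X$ the block diagonal $nT\times MT$ matrix with blocks $X_1,\dots,X_T$, and $\beta^*=(\beta^*_1,\dots,\beta^*_T)\in\mathbb R^{MT}$. For $\beta=(\beta_{tj})\in\mathbb R^{MT}$ and $j=1,\dots,M$ put $\beta^j=(\beta_{tj})_{t=1}^T\in\mathbb R^T$. Let $M(\beta)$ be the number of indices $j$ with $\beta^j\ne 0$, let $GS(s,M,T)=\{\beta\in\mathbb R^{MT}: M(\beta)\le s\}$, and let $\|\beta\|_{2,p}=\big(\sum_{j=1}^M\|\beta^j\|^p\big)^{1/p}$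 for $1\le p<\infty$ and $\|\beta\|_{2,\infty}=\max_{j}\|\beta^j\|$, where $\|\cdot\|$ is the Euclidean norm. For $\kappa_1,\kappa_2>0$ consider the conditions that, for every $\Delta\in\mathbb R^{MT}\setminus\{0\}$ with $M(\Delta)\le 2s$, $$\text{(a)}\quad \frac{\|X\Delta\|^2}{n\|\Delta\|^2}\ge\kappa_1^2,\qquad\qquad \text{(b)}\quad \frac{\|X\Delta\|^2}{n\|\Delta\|^2}\le\kappa_2^2 .$$ Define, for $1\le p\le\infty$ and with the convention $s^{1/\infty}=1$, $$\psi_{n,p}=\frac{\sigma}{\kappa_2}\,\frac{s^{1/p}}{\sqrt n}\left(1+\frac{\log(eM/s)}{T}\right)^{1/2}.$$ 1. For every $1\le p\le\infty$ there exist constants $\bar b,\bar c>0$ depending only on $\ell$ and $p$ such that, whenever (b) holds, $$\inf_\tau\ \sup_{\beta^*\in GS(s,M,T)}\mathbb E\,\ell\!\left(\bar b\,\psi_{n,p}^{-1}\,\frac1{\sqrt T}\,\|\tau-\beta^*\|_{2,p}\right)\ \ge\ \bar c .$$ 2. There exist constants $\bar b,\bar c>0$ depending only on $\ell$ such that, whenever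 both (a) and (b) hold, $$\inf_\tau\ \sup_{\beta^*\in GS(s,M,T)}\mathbb E\,\ell\!\left(\bar b\,\psi_{n,2}^{-1}\,\frac1{\kappa_1\sqrt{nT}}\,\|X(\tau-\beta^*)\|\right)\ \ge\ \bar c .$$ Here $\inf_\tau$ is the infimum over all estimators, that is, over all measurable functions $\tau=\tau(y)$ of the observations with values in $\mathbb R^{MT}$. -/

import Mathlib

open MeasureTheory ProbabilityTheory
open scoped NNReal ENNReal

noncomputable section

namespace MultiTask

/-- Coefficient vectors `β ∈ ℝ^{MT}`: the entry `β (j, t)` is the coefficient of the `j`-th variable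
in the `t`-th regression equation. -/
abbrev Coef (M T : ℕ) : Type := EuclideanSpace ℝ (Fin M × Fin T)

/-- Response vectors `y ∈ ℝ^{nT}`: the entry `y (i, t)` is the `i`-th observation of task `t`. -/
abbrev Resp (n T : ℕ) : Type := EuclideanSpace ℝ (Fin n × Fin T)

/-- The vector `X β`, where `X` is the `nT × MT` block diagonal matrix whose `t`-th block is the
`n × M` design matrix `X t` of task `t`. -/
def predict {n M T : ℕ} (X : Fin T → Matrix (Fin n) (Fin M) ℝ) (β : Coef M T) : Resp n T :=
  WithLp.toLp 2 ((Matrix.blockDiagonal X).mulVec β.ofLp)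

/-- The group `β^j ∈ ℝ^T`: the coefficients of the `j`-th variable across the tasks. -/
def group {M T : ℕ} (β : Coef M T) (j : Fin M) : EuclideanSpace ℝ (Fin T) :=
  WithLp.toLp 2 (fun t => β (j, t))

/-- The mixed norm `‖β‖_{2,p}`: the `ℓ_p` norm (the maximum when `p = ∞`) of the Euclidean norms
`‖β^j‖`, `j = 1, …, M`. -/
def mixedNorm {M T : ℕ} (p : ℝ≥0∞) (β : Coef M T) : ℝ :=
  ‖(WithLp.toLp p (fun j => ‖group β j‖) : PiLp p (fun _ : Fin M => ℝ))‖

open Classical in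
/-- The number `M(β)` of indices `j` such that `β^j ≠ 0`. -/
def numGroups {M T : ℕ} (β : Coef M T) : ℕ :=
  (Finset.univ.filter (fun j : Fin M => group β j ≠ 0)).card

/-- The set `GS(s, M, T)` of group `s`-sparse vectors. -/
def GS (s M T : ℕ) : Set (Coef M T) :=
  {β | numGroups β ≤ s}

/-- `‖XΔ‖² / (n ‖Δ‖²) ≥ κ²` for every `Δ ≠ 0` with `M(Δ) ≤ 2s`. -/
def LowerRE {n M T : ℕ} (X : Fin T → Matrix (Fin n) (Fin M) ℝ) (s : ℕ) (κ : ℝ) : Prop :=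
  ∀ Δ : Coef M T, Δ ≠ 0 → numGroups Δ ≤ 2 * s →
    κ ^ 2 ≤ ‖predict X Δ‖ ^ 2 / ((n : ℝ) * ‖Δ‖ ^ 2)

/-- `‖XΔ‖² / (n ‖Δ‖²) ≤ κ²` for every `Δ ≠ 0` with `M(Δ) ≤ 2s`. -/
def UpperRE {n M T : ℕ} (X : Fin T → Matrix (Fin n) (Fin M) ℝ) (s : ℕ) (κ : ℝ) : Prop :=
  ∀ Δ : Coef M T, Δ ≠ 0 → numGroups Δ ≤ 2 * s →
    ‖predict X Δ‖ ^ 2 / ((n : ℝ) * ‖Δ‖ ^ 2) ≤ κ ^ 2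

/-- The rate `ψ_{n,p} = (σ/κ₂) (s^{1/p}/√n) (1 + log(eM/s)/T)^{1/2}`; the exponent `1/p` is `0`
when `p = ∞`. -/
def rate (n M T s : ℕ) (σ κ₂ : ℝ) (p : ℝ≥0∞) : ℝ :=
  σ / κ₂ * ((s : ℝ) ^ (p⁻¹).toReal / √(n : ℝ)) *
    √(1 + Real.log (Real.exp 1 * (M : ℝ) / (s : ℝ)) / (T : ℝ))

/-- The family `W` of noise variables is i.i.d. `N(0, σ²)` under `P`. -/
def IsGaussianNoise {Ω : Type*} [MeasurableSpace Ω] (P : Measure Ω) {n T : ℕ}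
    (W : Fin n × Fin T → Ω → ℝ) (σ : ℝ) : Prop :=
  (∀ k, HasLaw (W k) (gaussianReal 0 (Real.toNNReal (σ ^ 2))) P) ∧ iIndepFun W P

/-- The response `y = X β + W` of the multi-task regression model. -/
def response {Ω : Type*} {n M T : ℕ} (X : Fin T → Matrix (Fin n) (Fin M) ℝ)
    (W : Fin n × Fin T → Ω → ℝ) (β : Coef M T) (ω : Ω) : Resp n T :=
  predict X β + WithLp.toLp 2 (fun k => W k ω)

/-- The minimax risk `inf_τ sup_{β ∈ GS(s,M,T)} E ℓ(d(τ(y), β))`, where `τ` ranges over all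
estimators, that is, measurable functions of the response `y = X β + W`. -/
def minimaxRisk {Ω : Type*} [MeasurableSpace Ω] (P : Measure Ω) {n M T : ℕ}
    (X : Fin T → Matrix (Fin n) (Fin M) ℝ) (W : Fin n × Fin T → Ω → ℝ) (s : ℕ)
    (ℓ : ℝ≥0 → ℝ≥0) (d : Coef M T → Coef M T → ℝ) : ℝ≥0∞ :=
  ⨅ (τ : Resp n T → Coef M T) (_ : Measurable τ), ⨆ β ∈ GS s M T,
    ∫⁻ ω, (ℓ (Real.toNNReal (d (τ (response X W β ω)) β)) : ℝ≥0∞) ∂P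

end MultiTask

end

/-!
The proof is Bayesian: the parameter is drawn uniformly from an `m`-ary cube `θ ↦ B θ` of vectors in
`GS s M T`, and an estimator with small loss would recover most of the coordinates of `θ`.

*Testing one coordinate.* For Gaussian noise, `P(b + W ∈ A) ≤ exp(‖b - a‖² / (2σ²)) √P(a + W ∈ A)`
by Cauchy–Schwarz applied to the likelihood ratio (`IsGaussianNoise.measure_add_le`). If the `m`
values of a coordinate give predictions with squared distances at most `σ² log m / 2`, a second
Cauchy–Schwarz bounds the average success probability of any decision on that coordinate by
`m^{-1/4} ≤ 17/20`. This takes the place of Fano's inequality, and is uniform in `m ≥ 2`.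

*From coordinates to the loss.* Averaging over the cube and Markov's inequality give a `θ` for which
a tenth of the coordinates are wrong with probability at least `1/20` (`exists_hammingDist_ge`). A
measurable nearest-point decision and the triangle inequality turn this into a bound on the minimax
risk for any loss `c ‖Φ (τ - β)‖` with `Φ` linear (`le_minimaxRisk_norm`), which covers the mixed
norms and the prediction loss; for the latter, condition (a) is applied to differences of the `B θ`.

*The cubes.* The rate involves `T + log (e M / s)`. If `T` dominates, the entries of `s` fixed
groups are `0` or `γ` freely (`exists_dense_family`); otherwise each of `s` blocks of `m = ⌊M / s⌋`
variables contains one entry `γ`, at an unknown place (`exists_sparse_family`). In both cases a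
positive fraction of `s` groups has error of the order of `√T` times the rate without the factor
`s^{1/p}`, which gives a separation in every mixed norm with the same numerical constant
(`exists_hypotheses`).
-/

namespace MultiTask


/-! ### Change of measure for Gaussian shifts -/

section GaussianShift

theorem lintegral_pi_prod_eq_prod_lintegral {ι : Type*} [Fintype ι] {E : ι → Type*}
    [∀ i, MeasurableSpace (E i)] (μ : ∀ i, Measure (E i)) [∀ i, IsProbabilityMeasure (μ i)]
    {f : ∀ i, E i → ℝ≥0∞} (hf : ∀ i, Measurable (f i)) :
    ∫⁻ x, ∏ i, f i (x i) ∂Measure.pi μ = ∏ i, ∫⁻ x, f i x ∂μ i := by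
  have h := lintegral_prod_eq_prod_lintegral_of_indepFun (μ := Measure.pi μ) Finset.univ
    (fun i (x : ∀ i, E i) => f i (x i)) (iIndepFun_pi fun i => (hf i).aemeasurable)
    (fun i => (hf i).comp (measurable_pi_apply i))
  rw [h]
  exact Finset.prod_congr rfl fun i _ => (measurePreserving_eval μ i).lintegral_comp (hf i)

/-- The likelihood ratio `dN(d, v) / dN(0, v)`. -/
noncomputable def gaussianRatio (v : ℝ≥0) (d x : ℝ) : ℝ≥0∞ :=
  ENNReal.ofReal (Real.exp (d * x / v - d ^ 2 / (2 * v)))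

theorem measurable_gaussianRatio (v : ℝ≥0) (d : ℝ) : Measurable (gaussianRatio v d) := by
  unfold gaussianRatio
  fun_prop

theorem gaussianReal_eq_withDensity {v : ℝ≥0} (hv : v ≠ 0) (d : ℝ) :
    gaussianReal d v = (gaussianReal 0 v).withDensity (gaussianRatio v d) := by
  rw [gaussianReal_of_var_ne_zero _ hv, gaussianReal_of_var_ne_zero _ hv,
    ← withDensity_mul _ (measurable_gaussianPDF 0 v) (measurable_gaussianRatio v d)]
  congr 1
  ext x
  have hv' : (v : ℝ) ≠ 0 := by exact_mod_cast hv
  rw [Pi.mul_apply, gaussianPDF, gaussianPDF, gaussianRatio,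
    ← ENNReal.ofReal_mul (gaussianPDFReal_nonneg _ _ _), gaussianPDFReal, gaussianPDFReal,
    mul_assoc (_)⁻¹, ← Real.exp_add]
  congr 3
  field_simp
  ring

theorem lintegral_gaussianRatio {v : ℝ≥0} (hv : v ≠ 0) (d : ℝ) :
    ∫⁻ x, gaussianRatio v d x ∂gaussianReal 0 v = 1 := by
  rw [← setLIntegral_univ, ← withDensity_apply _ MeasurableSet.univ,
    ← gaussianReal_eq_withDensity hv, measure_univ]

/-- The second moment of the likelihood ratio, from `ratio(d)² = exp(d²/v) ratio(2d)`. -/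
theorem lintegral_gaussianRatio_sq {v : ℝ≥0} (hv : v ≠ 0) (d : ℝ) :
    ∫⁻ x, gaussianRatio v d x ^ 2 ∂gaussianReal 0 v = ENNReal.ofReal (Real.exp (d ^ 2 / v)) := by
  have hv' : (v : ℝ) ≠ 0 := by exact_mod_cast hv
  have h : ∀ x, gaussianRatio v d x ^ 2
      = ENNReal.ofReal (Real.exp (d ^ 2 / v)) * gaussianRatio v (2 * d) x := by
    intro x
    rw [gaussianRatio, gaussianRatio, ← ENNReal.ofReal_pow (Real.exp_nonneg _),
      ← ENNReal.ofReal_mul (Real.exp_nonneg _), ← Real.exp_nat_mul, ← Real.exp_add]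
    congr 2
    field_simp
    push_cast
    ring
  simp_rw [h]
  rw [lintegral_const_mul _ (measurable_gaussianRatio _ _), lintegral_gaussianRatio hv, mul_one]

theorem pi_gaussianReal_eq_withDensity {κ : Type*} [Fintype κ] {v : ℝ≥0} (hv : v ≠ 0)
    (d : κ → ℝ) :
    Measure.pi (fun k => gaussianReal (d k) v)
      = (Measure.pi fun _ : κ => gaussianReal 0 v).withDensity
          (fun x => ∏ k, gaussianRatio v (d k) (x k)) := by
  refine Measure.pi_eq fun s hs => ?_
  rw [withDensity_apply _ (MeasurableSet.univ_pi hs),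
    ← lintegral_indicator (MeasurableSet.univ_pi hs)]
  have h : ∀ x : κ → ℝ, (Set.univ.pi s).indicator
      (fun x => ∏ k, gaussianRatio v (d k) (x k)) x
      = ∏ k, (s k).indicator (gaussianRatio v (d k)) (x k) := by
    intro x
    by_cases hx : x ∈ Set.univ.pi s
    · rw [Set.indicator_of_mem hx]
      exact Finset.prod_congr rfl fun k _ => (Set.indicator_of_mem (hx k trivial) _).symm
    · rw [Set.indicator_of_notMem hx]
      simp only [Set.mem_pi, Set.mem_univ, true_implies, not_forall] at hx
      obtain ⟨k, hk⟩ := hx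
      exact (Finset.prod_eq_zero (Finset.mem_univ k) (Set.indicator_of_notMem hk _)).symm
  simp_rw [h]
  rw [lintegral_pi_prod_eq_prod_lintegral _
    fun k => (measurable_gaussianRatio v (d k)).indicator (hs k)]
  refine Finset.prod_congr rfl fun k _ => ?_
  rw [lintegral_indicator (hs k), ← withDensity_apply _ (hs k), ← gaussianReal_eq_withDensity hv]

/-- Change of measure between two Gaussian product measures: Cauchy–Schwarz against the likelihood
ratio, whose second moment is `exp(‖d‖²/v)`. -/
theorem pi_gaussianReal_le {κ : Type*} [Fintype κ] {v : ℝ≥0} (hv : v ≠ 0) (d : κ → ℝ)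
    {A : Set (κ → ℝ)} (hA : MeasurableSet A) :
    Measure.pi (fun k => gaussianReal (d k) v) A
      ≤ (Measure.pi (fun _ : κ => gaussianReal 0 v) A) ^ (1 / 2 : ℝ)
        * ENNReal.ofReal (Real.exp ((∑ k, d k ^ 2) / (2 * v))) := by
  set G : Measure (κ → ℝ) := Measure.pi fun _ : κ => gaussianReal 0 v
  set R : (κ → ℝ) → ℝ≥0∞ := fun x => ∏ k, gaussianRatio v (d k) (x k)
  have hR : Measurable R :=
    Finset.measurable_prod _ fun k _ =>
      (measurable_gaussianRatio v (d k)).comp (measurable_pi_apply k)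
  have hR2 : ∫⁻ x, R x ^ (2 : ℝ) ∂G = ENNReal.ofReal (Real.exp ((∑ k, d k ^ 2) / v)) := by
    simp_rw [R, ENNReal.rpow_two, ← Finset.prod_pow]
    rw [lintegral_pi_prod_eq_prod_lintegral _
      fun k => (measurable_gaussianRatio v (d k)).pow_const 2]
    simp_rw [lintegral_gaussianRatio_sq hv]
    rw [← ENNReal.ofReal_prod_of_nonneg fun _ _ => Real.exp_nonneg _, ← Real.exp_sum,
      Finset.sum_div]
  rw [pi_gaussianReal_eq_withDensity hv, withDensity_apply _ hA, ← lintegral_indicator hA]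
  have hmul : ∀ x, A.indicator R x = (A.indicator (fun _ => (1 : ℝ≥0∞)) * R) x := by
    intro x
    by_cases hx : x ∈ A <;> simp [hx]
  have hind : ∀ x, A.indicator (fun _ => (1 : ℝ≥0∞)) x ^ (2 : ℝ)
      = A.indicator (fun _ => (1 : ℝ≥0∞)) x := by
    intro x
    by_cases hx : x ∈ A <;> simp [hx]
  calc ∫⁻ x, A.indicator R x ∂G
      = ∫⁻ x, (A.indicator (fun _ => (1 : ℝ≥0∞)) * R) x ∂G := lintegral_congr hmul
    _ ≤ (∫⁻ x, A.indicator (fun _ => (1 : ℝ≥0∞)) x ^ (2 : ℝ) ∂G) ^ (1 / 2 : ℝ)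
        * (∫⁻ x, R x ^ (2 : ℝ) ∂G) ^ (1 / 2 : ℝ) :=
      ENNReal.lintegral_mul_le_Lp_mul_Lq G Real.HolderConjugate.two_two
        (measurable_const.indicator hA).aemeasurable hR.aemeasurable
    _ = _ := by
      rw [hR2, lintegral_congr hind, lintegral_indicator_const hA, one_mul,
        ENNReal.ofReal_rpow_of_pos (Real.exp_pos _), ← Real.exp_mul]
      congr 3
      ring

variable {Ω : Type*} [MeasurableSpace Ω] {P : Measure Ω} {n T : ℕ}
  {W : Fin n × Fin T → Ω → ℝ} {σ : ℝ}

theorem IsGaussianNoise.aemeasurable (hW : IsGaussianNoise P W σ) :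
    AEMeasurable (fun ω => (WithLp.toLp 2 fun k => W k ω : Resp n T)) P := by
  have h : AEMeasurable (fun ω k => W k ω) P :=
    aemeasurable_pi_lambda _ fun k => (hW.1 k).aemeasurable
  exact (WithLp.measurable_toLp 2 _).comp_aemeasurable h

/-- The change of measure for the model: an event has comparable probabilities under two mean
vectors at distance of order `σ`. -/
theorem IsGaussianNoise.measure_add_le [IsProbabilityMeasure P] (hW : IsGaussianNoise P W σ)
    (hσ : 0 < σ) (a b : Resp n T) {A : Set (Resp n T)} (hA : MeasurableSet A) :
    P.real {ω | b + WithLp.toLp 2 (fun k => W k ω) ∈ A}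
      ≤ √(P.real {ω | a + WithLp.toLp 2 (fun k => W k ω) ∈ A})
        * Real.exp (‖b - a‖ ^ 2 / (2 * σ ^ 2)) := by
  set v : ℝ≥0 := Real.toNNReal (σ ^ 2)
  have hv : v ≠ 0 := by
    simp only [v, ne_eq, Real.toNNReal_eq_zero, not_le]; positivity
  have hvσ : (v : ℝ) = σ ^ 2 := Real.coe_toNNReal _ (sq_nonneg σ)
  have hlaw := hW.2.hasLaw_pi hW.1
  set A' : Set (Fin n × Fin T → ℝ) := {z | a + WithLp.toLp 2 z ∈ A}
  have hA' : MeasurableSet A' :=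
    (measurable_const.add (WithLp.measurable_toLp 2 _)) hA
  set d : Fin n × Fin T → ℝ := fun k => (b - a) k
  have hmap : Measure.pi (fun k => gaussianReal (d k) v)
      = (Measure.pi fun _ => gaussianReal 0 v).map (fun z k => d k + z k) := by
    have h := Measure.pi_map_pi (μ := fun _ : Fin n × Fin T => gaussianReal 0 v)
      (f := fun k z => d k + z) (fun k => by fun_prop)
    rw [h]
    congr 1
    ext1 k
    rw [gaussianReal_map_const_add, zero_add]
  have h1 : P {ω | b + WithLp.toLp 2 (fun k => W k ω) ∈ A}
      = Measure.pi (fun k => gaussianReal (d k) v) A' := by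
    rw [hmap, Measure.map_apply (by fun_prop) hA']
    have hm : MeasurableSet {z : Fin n × Fin T → ℝ | b + WithLp.toLp 2 z ∈ A} :=
      (measurable_const.add (WithLp.measurable_toLp 2 _)) hA
    rw [hlaw.measure_eq hm]
    congr 1
    ext z
    simp only [A', d, Set.mem_ofPred_eq, Set.mem_preimage]
    have : a + WithLp.toLp 2 (fun k => (b - a) k + z k) = b + WithLp.toLp 2 z := by
      ext k
      simp
      ring
    rw [this]
  have h0 : P {ω | a + WithLp.toLp 2 (fun k => W k ω) ∈ A}
      = Measure.pi (fun _ => gaussianReal 0 v) A' := hlaw.measure_eq hA'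
  have hle := pi_gaussianReal_le hv d hA'
  rw [← h1, ← h0, hvσ] at hle
  have hd : ∑ k, d k ^ 2 = ‖b - a‖ ^ 2 := (EuclideanSpace.real_norm_sq_eq _).symm
  rw [hd] at hle
  have := ENNReal.toReal_mono (by finiteness) hle
  rwa [ENNReal.toReal_mul, ENNReal.toReal_ofReal (Real.exp_nonneg _), ← ENNReal.toReal_rpow,
    ← Real.sqrt_eq_rpow] at this

end GaussianShift



/-! ### Assouad's lemma over an m-ary cube -/

section Assouad

/-- Minimisers over a finite set can be chosen measurably. -/
theorem exists_measurable_argmin {α Θ : Type*} [MeasurableSpace α] [MeasurableSpace Θ]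
    [Finite Θ] [Nonempty Θ] [DiscreteMeasurableSpace Θ] {f : Θ → α → ℝ}
    (hf : ∀ θ, Measurable (f θ)) :
    ∃ g : α → Θ, Measurable g ∧ ∀ a θ, f (g a) a ≤ f θ a := by
  classical
  have := Fintype.ofFinite Θ
  suffices h : ∀ S : Finset Θ, ∃ g : α → Θ, Measurable g ∧ ∀ a, ∀ θ ∈ S, f (g a) a ≤ f θ a by
    obtain ⟨g, hg, hmin⟩ := h Finset.univ
    exact ⟨g, hg, fun a θ => hmin a θ (Finset.mem_univ θ)⟩
  intro S
  induction S using Finset.induction_on with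
  | empty => exact ⟨fun _ => Classical.arbitrary Θ, measurable_const, by simp⟩
  | insert θ₀ S _ ih =>
    obtain ⟨g, hg, hmin⟩ := ih
    have hu : Measurable fun x : Θ × α => f x.1 x.2 := measurable_from_prod_countable_right hf
    have hfg : Measurable fun a => f (g a) a := hu.comp (hg.prodMk measurable_id)
    refine ⟨fun a => if f θ₀ a ≤ f (g a) a then θ₀ else g a,
      Measurable.ite (measurableSet_le (hf θ₀) hfg) measurable_const hg, fun a θ hθ => ?_⟩
    rcases Finset.mem_insert.1 hθ with rfl | hθ
    · dsimp only
      split_ifs with h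
      · exact le_rfl
      · exact (not_le.1 h).le
    · dsimp only
      split_ifs with h
      · exact h.trans (hmin a θ hθ)
      · exact hmin a θ hθ

/-- Resampling one coordinate of a point of the cube does not change a uniform average. -/
theorem sum_sum_update {ι : Type*} [Fintype ι] [DecidableEq ι] {κ : Type*} [Fintype κ]
    (i : ι) (F : (ι → κ) → ℝ) :
    ∑ θ, ∑ k, F (Function.update θ i k) = Fintype.card κ * ∑ θ, F θ := by
  classical
  have hinv : Function.Involutive
      (fun x : (ι → κ) × κ => (Function.update x.1 i x.2, x.1 i)) := by
    rintro ⟨θ, k⟩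
    simp
  have h := Equiv.sum_comp hinv.toPerm (fun x : (ι → κ) × κ => F x.1)
  rw [Fintype.sum_prod_type, Fintype.sum_prod_type] at h
  simpa [Finset.mul_sum] using h

variable {Ω : Type*} [MeasurableSpace Ω] {P : Measure Ω} [IsProbabilityMeasure P]
  {ι : Type*} [Fintype ι] {m : ℕ}

theorem sum_sqrt_measureReal_le {f : Ω → Fin m} (hf : AEMeasurable f P) :
    ∑ k, √(P.real {ω | f ω = k}) ≤ √(m : ℝ) := by
  have hsum : ∑ k, P.real {ω | f ω = k} = 1 := by
    have := Measure.isProbabilityMeasure_map hf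
    have h : ∑ k : Fin m, (P.map f).real {k} = 1 := by
      rw [sum_measureReal_singleton]; simp
    rw [← h]
    refine Finset.sum_congr rfl fun k _ => ?_
    rw [map_measureReal_apply_of_aemeasurable hf (measurableSet_singleton k)]
    rfl
  apply Real.le_sqrt_of_sq_le
  calc (∑ k, √(P.real {ω | f ω = k})) ^ 2
      ≤ (Finset.univ : Finset (Fin m)).card * ∑ k, √(P.real {ω | f ω = k}) ^ 2 :=
        sq_sum_le_card_mul_sum_sq
    _ = m := by
        simp_rw [Real.sq_sqrt measureReal_nonneg]
        rw [hsum]; simp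

/-- Markov's inequality for the Hamming loss: if on average at most `17/20` of the coordinates are
correct, then at least a tenth of them are wrong with probability at least `1/20`. -/
theorem le_measureReal_hammingDist [Nonempty ι] (θ : ι → Fin m) {g : Ω → ι → Fin m}
    (hg : AEMeasurable g P)
    (h : ∑ i, P.real {ω | g ω i = θ i} ≤ 17 / 20 * Fintype.card ι) :
    1 / 20 ≤ P.real {ω | Fintype.card ι ≤ 10 * hammingDist (g ω) θ} := by
  have hN : (0 : ℝ) < Fintype.card ι := by exact_mod_cast Fintype.card_pos
  have hms : ∀ i, NullMeasurableSet {ω | g ω i = θ i} P := fun i =>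
    ((measurable_pi_apply i).comp_aemeasurable hg).nullMeasurableSet_preimage
      (measurableSet_singleton (θ i))
  set F : Ω → ℝ := fun ω => ∑ i, {ω | g ω i = θ i}.indicator (fun _ => (1 : ℝ)) ω
  have hint : ∀ i, Integrable ({ω | g ω i = θ i}.indicator (fun _ => (1 : ℝ))) P := fun i =>
    (integrable_const (1 : ℝ)).indicator₀ (hms i)
  have hF : Integrable F P := integrable_finsetSum _ fun i _ => hint i
  have hFint : ∫ ω, F ω ∂P = ∑ i, P.real {ω | g ω i = θ i} := by
    rw [integral_finsetSum _ fun i _ => hint i]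
    refine Finset.sum_congr rfl fun i _ => ?_
    rw [integral_indicator₀ (hms i)]
    simp
  have hFham : ∀ ω, F ω + hammingDist (g ω) θ = Fintype.card ι := by
    intro ω
    have h1 : F ω = ((Finset.univ.filter fun i => g ω i = θ i).card : ℝ) := by
      simp [F, Set.indicator_apply]
    rw [h1, hammingDist]
    exact_mod_cast Finset.card_filter_add_card_filter_not (s := Finset.univ)
      (fun i => g ω i = θ i)
  -- `F` counts the correct coordinates; `9/10` exceeds the mean fraction `17/20`.
  have hmark := mul_meas_ge_le_integral_of_nonneg (μ := P) (f := F)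
    (Filter.Eventually.of_forall fun ω =>
      Finset.sum_nonneg fun i _ => Set.indicator_nonneg (fun _ _ => zero_le_one) ω) hF
    (9 / 10 * Fintype.card ι)
  rw [hFint] at hmark
  set B : Set Ω := {ω | Fintype.card ι ≤ 10 * hammingDist (g ω) θ}
  have hB : NullMeasurableSet B P :=
    hg.nullMeasurableSet_preimage (s := {x | Fintype.card ι ≤ 10 * hammingDist x θ})
      (MeasurableSet.of_discrete)
  have hsub : Bᶜ ⊆ {ω | 9 / 10 * (Fintype.card ι : ℝ) ≤ F ω} := by
    intro ω hω
    have h2 : 10 * hammingDist (g ω) θ < Fintype.card ι := not_le.1 hω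
    have h3 : (10 : ℝ) * hammingDist (g ω) θ < Fintype.card ι := by exact_mod_cast h2
    have := hFham ω
    change 9 / 10 * (Fintype.card ι : ℝ) ≤ F ω
    linarith
  have hle : P.real Bᶜ ≤ P.real {ω | 9 / 10 * (Fintype.card ι : ℝ) ≤ F ω} := measureReal_mono hsub
  have hc : P.real Bᶜ = 1 - P.real B := probReal_compl_eq_one_sub₀ hB
  have h4 : 9 / 10 * (Fintype.card ι : ℝ) * P.real Bᶜ ≤ 17 / 20 * Fintype.card ι :=
    (mul_le_mul_of_nonneg_left hle (by positivity)).trans (hmark.trans h)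
  have h5 : 9 / 10 * P.real Bᶜ ≤ 17 / 20 := by
    refine le_of_mul_le_mul_right ?_ hN
    linarith
  linarith

/-- A version of Assouad's lemma over an `m`-ary cube. If, for each coordinate, changing it costs at
most a factor `C` in the comparison of the laws (in the square root form of the change of measure),
with `C √m ≤ (17/20) m`, then no family of decisions gets most coordinates right. -/
theorem exists_hammingDist_ge [DecidableEq ι] [Nonempty ι] {C : ℝ} (hC0 : 0 ≤ C) (hm : 0 < m)
    (hC : C * √(m : ℝ) ≤ 17 / 20 * m) {g : (ι → Fin m) → Ω → ι → Fin m}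
    (hg : ∀ θ, AEMeasurable (g θ) P)
    (h : ∀ θ i k, P.real {ω | g (Function.update θ i k) ω i = k}
      ≤ √(P.real {ω | g θ ω i = k}) * C) :
    ∃ θ, 1 / 20 ≤ P.real {ω | Fintype.card ι ≤ 10 * hammingDist (g θ ω) θ} := by
  have : Nonempty (Fin m) := ⟨⟨0, hm⟩⟩
  have hm' : (0 : ℝ) < m := by exact_mod_cast hm
  have hcoord : ∀ i, ∑ θ, P.real {ω | g θ ω i = θ i}
      ≤ ∑ _θ : ι → Fin m, (17 / 20 : ℝ) := by
    intro i
    have h1 : ∀ θ : ι → Fin m,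
        ∑ k, P.real {ω | g (Function.update θ i k) ω i = Function.update θ i k i}
          ≤ 17 / 20 * m := by
      intro θ
      simp only [Function.update_self]
      calc ∑ k, P.real {ω | g (Function.update θ i k) ω i = k}
          ≤ ∑ k, √(P.real {ω | g θ ω i = k}) * C := Finset.sum_le_sum fun k _ => h θ i k
        _ = C * ∑ k, √(P.real {ω | g θ ω i = k}) := by rw [← Finset.sum_mul, mul_comm]
        _ ≤ C * √(m : ℝ) := mul_le_mul_of_nonneg_left
            (sum_sqrt_measureReal_le ((measurable_pi_apply i).comp_aemeasurable (hg θ))) hC0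
        _ ≤ _ := hC
    have h2 := Finset.sum_le_sum fun θ (_ : θ ∈ Finset.univ) => h1 θ
    rw [sum_sum_update i fun θ => P.real {ω | g θ ω i = θ i}, Fintype.card_fin,
      ← Finset.sum_mul, mul_comm] at h2
    exact le_of_mul_le_mul_right h2 hm'
  have havg : ∑ θ, ∑ i, P.real {ω | g θ ω i = θ i}
      ≤ ∑ _θ : ι → Fin m, 17 / 20 * (Fintype.card ι : ℝ) := by
    rw [Finset.sum_comm]
    refine (Finset.sum_le_sum fun i _ => hcoord i).trans_eq ?_
    simp
    ring
  obtain ⟨θ, -, hθ⟩ := Finset.exists_le_of_sum_le Finset.univ_nonempty havg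
  exact ⟨θ, le_measureReal_hammingDist θ (hg θ) hθ⟩

/-- `m^{3/4} ≤ (17/20) m` for `m ≥ 2`, as `2^{-1/4} < 17/20`. -/
theorem exp_log_mul_sqrt_le (hm : 2 ≤ m) :
    Real.exp (Real.log m / 4) * √(m : ℝ) ≤ 17 / 20 * m := by
  have hm' : (2 : ℝ) ≤ m := by exact_mod_cast hm
  have hm0 : (0 : ℝ) < m := by linarith
  have h4 : Real.exp (Real.log m / 4) ^ 4 = m := by
    rw [← Real.exp_nat_mul]
    push_cast
    rw [mul_div_cancel₀ _ (by norm_num : (4 : ℝ) ≠ 0), Real.exp_log hm0]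
  refine le_of_pow_le_pow_left₀ (n := 4) (by norm_num) (by positivity) ?_
  have h2 : √(m : ℝ) ^ 4 = (m : ℝ) ^ 2 := by
    rw [show (4 : ℕ) = 2 * 2 from rfl, pow_mul, Real.sq_sqrt hm0.le]
  rw [mul_pow, mul_pow, h4, h2]
  nlinarith [pow_pos hm0 3]

end Assouad

/-! ### From the minimax risk to the cube -/

section Reduction

variable {Ω : Type*} [MeasurableSpace Ω] {P : Measure Ω} [IsProbabilityMeasure P] {n M T : ℕ}
  {W : Fin n × Fin T → Ω → ℝ} {σ : ℝ}

/-- Reduction of the minimax risk to a decision problem on an `m`-ary cube of parameters `B θ`: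
neighbouring parameters are hard to tell apart, and parameters which differ in a tenth of
the coordinates are separated, in the sense that no `τ` is within loss `u` of both of them. -/
theorem le_minimaxRisk (X : Fin T → Matrix (Fin n) (Fin M) ℝ) (hW : IsGaussianNoise P W σ)
    (hσ : 0 < σ) {s : ℕ} {ℓ : ℝ≥0 → ℝ≥0} (hℓ : Monotone ℓ) {d : Coef M T → Coef M T → ℝ}
    (hd : ∀ β, Measurable fun τ => d τ β)
    {ι : Type*} [Fintype ι] [DecidableEq ι] [Nonempty ι] {m : ℕ} (hm : 2 ≤ m)
    {B : (ι → Fin m) → Coef M T} (hB : ∀ θ, B θ ∈ GS s M T)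
    (hstep : ∀ θ i k, ‖predict X (B (Function.update θ i k)) - predict X (B θ)‖ ^ 2
      ≤ σ ^ 2 * Real.log m / 2)
    {u : ℝ≥0} (hsep : ∀ θ θ', Fintype.card ι ≤ 10 * hammingDist θ θ' →
      ∀ τ, d τ (B θ) ≤ d τ (B θ') → (u : ℝ) ≤ d τ (B θ')) :
    ENNReal.ofReal (ℓ u / 20) ≤ minimaxRisk P X W s ℓ d := by
  have hm0 : 0 < m := by omega
  have : Nonempty (Fin m) := ⟨⟨0, hm0⟩⟩
  refine le_iInf₂ fun τ hτ => ?_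
  obtain ⟨g, hg, hmin⟩ := exists_measurable_argmin
    (f := fun (θ : ι → Fin m) (y : Resp n T) => d (τ y) (B θ)) fun θ => (hd (B θ)).comp hτ
  have hy : ∀ β, AEMeasurable (fun ω => response X W β ω) P := fun β =>
    aemeasurable_const.add hW.aemeasurable
  obtain ⟨θ, hθ⟩ := exists_hammingDist_ge (P := P) (Real.exp_nonneg _) hm0
    (exp_log_mul_sqrt_le hm) (g := fun θ ω => g (response X W (B θ) ω))
    (fun θ => hg.comp_aemeasurable (hy _)) (by
      intro θ i k
      have hA : MeasurableSet {y : Resp n T | g y i = k} :=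
        ((measurable_pi_apply i).comp hg) (measurableSet_singleton k)
      refine (hW.measure_add_le hσ (predict X (B θ)) (predict X (B (Function.update θ i k)))
        hA).trans (mul_le_mul_of_nonneg_left (Real.exp_le_exp.2 ?_) (Real.sqrt_nonneg _))
      rw [div_le_div_iff₀ (by positivity) (by norm_num)]
      nlinarith [hstep θ i k])
  refine le_trans ?_ (le_iSup₂ (B θ) (hB θ))
  set A : Set Ω := {ω | Fintype.card ι ≤ 10 * hammingDist (g (response X W (B θ) ω)) θ}
  have hA : NullMeasurableSet A P :=
    (hg.comp_aemeasurable (hy (B θ))).nullMeasurableSet_preimage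
      (s := {x | Fintype.card ι ≤ 10 * hammingDist x θ}) MeasurableSet.of_discrete
  calc ENNReal.ofReal (ℓ u / 20) ≤ ℓ u * P A := by
        rw [← ofReal_measureReal, ← ENNReal.ofReal_coe_nnreal,
          ← ENNReal.ofReal_mul (NNReal.coe_nonneg _)]
        refine ENNReal.ofReal_le_ofReal ?_
        have := mul_le_mul_of_nonneg_left hθ (ℓ u).coe_nonneg
        linarith
    _ = ∫⁻ ω, A.indicator (fun _ => (ℓ u : ℝ≥0∞)) ω ∂P := (lintegral_indicator_const₀ hA _).symm
    _ ≤ _ := by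
        refine lintegral_mono fun ω => ?_
        by_cases hω : ω ∈ A
        · rw [Set.indicator_of_mem hω]
          have h := hsep _ _ hω (τ (response X W (B θ) ω)) (hmin _ θ)
          exact ENNReal.coe_le_coe.2 (hℓ (NNReal.le_toNNReal_of_coe_le h))
        · rw [Set.indicator_of_notMem hω]
          exact zero_le

/-- The reduction for a loss `c ‖Φ (τ - β)‖`: by the triangle inequality, if `Φ` maps parameters
to points at distance at least `2 u / c`, then no `τ` is within loss `u` of both of them. -/
theorem le_minimaxRisk_norm (X : Fin T → Matrix (Fin n) (Fin M) ℝ) (hW : IsGaussianNoise P W σ)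
    (hσ : 0 < σ) {s : ℕ} {ℓ : ℝ≥0 → ℝ≥0} (hℓ : Monotone ℓ)
    {F : Type*} [NormedAddCommGroup F] [NormedSpace ℝ F] (Φ : Coef M T →ₗ[ℝ] F)
    {c : ℝ} (hc : 0 < c)
    {ι : Type*} [Fintype ι] [DecidableEq ι] [Nonempty ι] {m : ℕ} (hm : 2 ≤ m)
    {B : (ι → Fin m) → Coef M T} (hB : ∀ θ, B θ ∈ GS s M T)
    (hstep : ∀ θ i k, ‖predict X (B (Function.update θ i k)) - predict X (B θ)‖ ^ 2
      ≤ σ ^ 2 * Real.log m / 2)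
    {u : ℝ≥0} (hsep : ∀ θ θ', Fintype.card ι ≤ 10 * hammingDist θ θ' →
      2 * u ≤ c * ‖Φ (B θ - B θ')‖) :
    ENNReal.ofReal (ℓ u / 20) ≤ minimaxRisk P X W s ℓ fun τ β => c * ‖Φ (τ - β)‖ := by
  have hΦ : Continuous Φ := Φ.continuous_of_finiteDimensional
  refine le_minimaxRisk X hW hσ hℓ (fun β => ?_) hm hB hstep fun θ θ' h τ hτ => ?_
  · exact (continuous_const.mul (hΦ.comp (continuous_id.sub continuous_const)).norm).measurable
  · have htri : ‖Φ (B θ - B θ')‖ ≤ ‖Φ (τ - B θ)‖ + ‖Φ (τ - B θ')‖ := by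
      have : Φ (B θ - B θ') = Φ (τ - B θ') - Φ (τ - B θ) := by rw [← map_sub]; congr 1; abel
      rw [this, add_comm]
      exact norm_sub_le _ _
    have h1 := hsep θ θ' h
    have h2 := mul_le_mul_of_nonneg_left htri hc.le
    linarith

end Reduction



/-! ### Mixed norms, sparsity and prediction -/

section Norms

variable {n M T : ℕ}

/-- `predict X` as a linear map. -/
noncomputable def predictₗ (X : Fin T → Matrix (Fin n) (Fin M) ℝ) : Coef M T →ₗ[ℝ] Resp n T where
  toFun := predict X
  map_add' a b := by simp [predict, Matrix.mulVec_add]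
  map_smul' c a := by simp [predict, Matrix.mulVec_smul]

@[simp]
theorem predictₗ_apply (X : Fin T → Matrix (Fin n) (Fin M) ℝ) (β : Coef M T) :
    predictₗ X β = predict X β := rfl

theorem predict_sub (X : Fin T → Matrix (Fin n) (Fin M) ℝ) (a b : Coef M T) :
    predict X (a - b) = predict X a - predict X b :=
  map_sub (predictₗ X) a b

/-- The groups of a coefficient vector, as a linear map into the `ℓ_p` product of the `ℝ^T`. -/
noncomputable def groupₗ (M T : ℕ) (p : ℝ≥0∞) :
    Coef M T →ₗ[ℝ] PiLp p (fun _ : Fin M => EuclideanSpace ℝ (Fin T)) where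
  toFun β := WithLp.toLp p fun j => group β j
  map_add' a b := by ext; simp [group]
  map_smul' c a := by ext; simp [group]

theorem norm_groupₗ (p : ℝ≥0∞) [Fact (1 ≤ p)] (β : Coef M T) :
    ‖groupₗ M T p β‖ = mixedNorm p β := by
  rcases eq_or_ne p ∞ with rfl | hp
  · simp [mixedNorm, groupₗ, PiLp.norm_eq_ciSup]
  · have hp0 : 0 < p.toReal :=
      ENNReal.toReal_pos (zero_lt_one.trans_le (Fact.out : 1 ≤ p)).ne' hp
    simp [mixedNorm, groupₗ, PiLp.norm_eq_sum hp0]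

theorem mixedNorm_two (β : Coef M T) : mixedNorm 2 β = ‖β‖ := by
  have h : ∀ j, ‖group β j‖ ^ 2 = ∑ t, β (j, t) ^ 2 := fun j => by
    rw [EuclideanSpace.real_norm_sq_eq]; rfl
  rw [mixedNorm, EuclideanSpace.norm_eq, EuclideanSpace.norm_eq]
  simp [h, Fintype.sum_prod_type]

/-- A vector with at least `s / 20` groups of norm at least `g` has large mixed norm; the constant
does not depend on `p` since `(s / 20)^{1/p} ≥ s^{1/p} / 20`. -/
theorem le_mixedNorm {p : ℝ≥0∞} (hp : 1 ≤ p) {s : ℕ} (hs : 1 ≤ s) (β : Coef M T)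
    (S : Finset (Fin M)) (hS : s ≤ 20 * S.card) {g : ℝ} (hg : 0 ≤ g)
    (h : ∀ j ∈ S, g ≤ ‖group β j‖) :
    (s : ℝ) ^ (p⁻¹).toReal * g / 20 ≤ mixedNorm p β := by
  rcases eq_or_ne p ∞ with rfl | hptop
  · obtain ⟨j, hj⟩ : S.Nonempty := by
      rw [← Finset.card_pos]; omega
    have h1 : ‖group β j‖ ≤ mixedNorm ∞ β := by
      have := PiLp.norm_apply_le
        (WithLp.toLp ∞ (fun j => ‖group β j‖) : PiLp ∞ (fun _ : Fin M => ℝ)) j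
      simpa [mixedNorm] using this
    have h2 := h j hj
    simp only [ENNReal.inv_top, ENNReal.toReal_zero, Real.rpow_zero]
    linarith
  · have hp1 : 1 ≤ p.toReal := by
      simpa using ENNReal.toReal_mono hptop hp
    have hp0 : 0 < p.toReal := by linarith
    set q := p.toReal
    rw [mixedNorm, PiLp.norm_eq_sum hp0]
    have hsum : (s / 20 : ℝ) * g ^ q ≤ ∑ j, ‖‖group β j‖‖ ^ q := by
      calc (s / 20 : ℝ) * g ^ q ≤ S.card * g ^ q := by
            refine mul_le_mul_of_nonneg_right ?_ (Real.rpow_nonneg hg _)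
            rw [div_le_iff₀ (by norm_num)]
            exact_mod_cast hS.trans_eq (mul_comm _ _)
        _ = ∑ j ∈ S, g ^ q := by simp
        _ ≤ ∑ j ∈ S, ‖‖group β j‖‖ ^ q := Finset.sum_le_sum fun j hj => by
            rw [norm_norm]; exact Real.rpow_le_rpow hg (h j hj) hp0.le
        _ ≤ _ := Finset.sum_le_sum_of_subset_of_nonneg (Finset.subset_univ S)
            fun j _ _ => Real.rpow_nonneg (norm_nonneg _) _
    have h2 := Real.rpow_le_rpow (by positivity) hsum (by positivity : 0 ≤ 1 / q)
    refine le_trans ?_ h2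
    rw [Real.mul_rpow (by positivity) (by positivity), ← Real.rpow_mul hg,
      mul_one_div_cancel hp0.ne', Real.rpow_one, ENNReal.toReal_inv, ← one_div,
      Real.div_rpow (by positivity) (by norm_num)]
    have h20 : (20 : ℝ) ^ (1 / q) ≤ 20 := by
      conv_rhs => rw [← Real.rpow_one 20]
      exact Real.rpow_le_rpow_of_exponent_le (by norm_num) ((div_le_one hp0).2 hp1)
    rw [mul_div_right_comm]
    gcongr

theorem mixedNorm_nonneg {p : ℝ≥0∞} (hp : 1 ≤ p) (β : Coef M T) : 0 ≤ mixedNorm p β := by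
  have := Fact.mk hp
  rw [← norm_groupₗ]
  exact norm_nonneg _

theorem numGroups_sub_le (a b : Coef M T) : numGroups (a - b) ≤ numGroups a + numGroups b := by
  classical
  unfold numGroups
  refine (Finset.card_le_card ?_).trans (Finset.card_union_le _ _)
  intro j
  simp only [Finset.mem_filter, Finset.mem_univ, true_and, Finset.mem_union]
  intro h
  by_contra! hab
  apply h
  have : group (a - b) j = group a j - group b j := by ext; simp [group]
  rw [this, hab.1, hab.2, sub_zero]

theorem UpperRE.norm_predict_sub_sq_le {X : Fin T → Matrix (Fin n) (Fin M) ℝ} {s : ℕ} {κ : ℝ}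
    (h : UpperRE X s κ) (hn : 1 ≤ n) {a b : Coef M T} (ha : a ∈ GS s M T) (hb : b ∈ GS s M T) :
    ‖predict X a - predict X b‖ ^ 2 ≤ κ ^ 2 * (n * ‖a - b‖ ^ 2) := by
  rw [← predict_sub]
  rcases eq_or_ne (a - b) 0 with h0 | h0
  · rw [h0, show predict X 0 = 0 from map_zero (predictₗ X)]; simp
  · have hn' : (0 : ℝ) < n := by exact_mod_cast hn
    have hpos : 0 < (n : ℝ) * ‖a - b‖ ^ 2 := mul_pos hn' (pow_pos (norm_pos_iff.2 h0) 2)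
    have hab : numGroups (a - b) ≤ 2 * s := by
      have h1 : numGroups a ≤ s := ha
      have h2 : numGroups b ≤ s := hb
      have := numGroups_sub_le a b
      omega
    exact (div_le_iff₀ hpos).1 (h _ h0 hab)

theorem LowerRE.le_norm_predict_sub {X : Fin T → Matrix (Fin n) (Fin M) ℝ} {s : ℕ} {κ : ℝ}
    (h : LowerRE X s κ) (hn : 1 ≤ n) {a b : Coef M T} (ha : a ∈ GS s M T)
    (hb : b ∈ GS s M T) :
    κ * √(n : ℝ) * ‖a - b‖ ≤ ‖predict X (a - b)‖ := by
  rcases eq_or_ne (a - b) 0 with h0 | h0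
  · rw [h0]; simp
  · have hn' : (0 : ℝ) < n := by exact_mod_cast hn
    have hpos : 0 < (n : ℝ) * ‖a - b‖ ^ 2 := mul_pos hn' (pow_pos (norm_pos_iff.2 h0) 2)
    have hab : numGroups (a - b) ≤ 2 * s := by
      have h1 : numGroups a ≤ s := ha
      have h2 : numGroups b ≤ s := hb
      have := numGroups_sub_le a b
      omega
    have h3 := (le_div_iff₀ hpos).1 (h _ h0 hab)
    refine le_of_pow_le_pow_left₀ (n := 2) (by norm_num) (norm_nonneg _) ?_
    rw [mul_pow, mul_pow, Real.sq_sqrt hn'.le]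
    linarith

end Norms

/-! ### Two families of sparse vectors -/

section Hypotheses

variable {M T : ℕ}

/-- The coefficient vector equal to `γ` on `S` and to `0` elsewhere. -/
noncomputable def flatCoef (γ : ℝ) (S : Finset (Fin M × Fin T)) : Coef M T :=
  WithLp.toLp 2 fun x => if x ∈ S then γ else 0

theorem numGroups_flatCoef_le (γ : ℝ) (S : Finset (Fin M × Fin T)) :
    numGroups (flatCoef γ S) ≤ (S.image Prod.fst).card := by
  classical
  refine Finset.card_le_card fun j hj => ?_
  simp only [Finset.mem_filter, Finset.mem_univ, true_and] at hj
  by_contra hne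
  apply hj
  ext t
  have : (j, t) ∉ S := fun h => hne (Finset.mem_image_of_mem Prod.fst h)
  simp [group, flatCoef, this]

theorem flatCoef_sub_sq (γ : ℝ) (S S' : Finset (Fin M × Fin T)) (x : Fin M × Fin T) :
    (flatCoef γ S - flatCoef γ S') x ^ 2 = if x ∈ symmDiff S S' then γ ^ 2 else 0 := by
  by_cases h : x ∈ S <;> by_cases h' : x ∈ S' <;> simp [flatCoef, Finset.mem_symmDiff, h, h']

theorem norm_flatCoef_sub_sq (γ : ℝ) (S S' : Finset (Fin M × Fin T)) :
    ‖flatCoef γ S - flatCoef γ S'‖ ^ 2 = (symmDiff S S').card * γ ^ 2 := by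
  rw [EuclideanSpace.real_norm_sq_eq]
  simp_rw [flatCoef_sub_sq]
  simp

theorem le_norm_group_flatCoef_sub (γ : ℝ) (S S' : Finset (Fin M × Fin T))
    (j : Fin M) (N : Finset (Fin T)) (hN : ∀ t ∈ N, (j, t) ∈ symmDiff S S') :
    γ * √(N.card : ℝ) ≤ ‖group (flatCoef γ S - flatCoef γ S') j‖ := by
  refine le_of_pow_le_pow_left₀ (n := 2) (by norm_num) (norm_nonneg _) ?_
  rw [mul_pow, Real.sq_sqrt (Nat.cast_nonneg _), EuclideanSpace.real_norm_sq_eq]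
  calc γ ^ 2 * N.card = ∑ t ∈ N, (flatCoef γ S - flatCoef γ S') (j, t) ^ 2 := by
        rw [Finset.sum_congr rfl fun t ht => by rw [flatCoef_sub_sq, if_pos (hN t ht)]]
        simp [mul_comm]
    _ ≤ _ := Finset.sum_le_sum_of_subset_of_nonneg (Finset.subset_univ N)
        fun t _ _ => sq_nonneg _

/-- The family of all `0`/`γ` vectors supported on `s` given groups. -/
theorem exists_dense_family {s : ℕ} (hs : 1 ≤ s) (hsM : s ≤ M) {γ : ℝ} (hγ : 0 ≤ γ) :
    ∃ B : (Fin s × Fin T → Fin 2) → Coef M T,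
      (∀ θ, B θ ∈ GS s M T) ∧
      (∀ θ i k, ‖B (Function.update θ i k) - B θ‖ ^ 2 ≤ 2 * γ ^ 2) ∧
      ∀ p : ℝ≥0∞, 1 ≤ p → ∀ θ θ',
        Fintype.card (Fin s × Fin T) ≤ 10 * hammingDist θ θ' →
        (s : ℝ) ^ (p⁻¹).toReal * (γ * √((T : ℝ) / 20)) / 20 ≤ mixedNorm p (B θ - B θ') := by
  classical
  set e : Fin s × Fin T ↪ Fin M × Fin T := (Fin.castLEEmb hsM).prodMap (Function.Embedding.refl _)
  set S : (Fin s × Fin T → Fin 2) → Finset (Fin M × Fin T) :=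
    fun θ => (Finset.univ.filter fun x => θ x = 1).map e
  have hmem : ∀ θ x, e x ∈ S θ ↔ θ x = 1 := fun θ x => by simp [S]
  have hdiff : ∀ θ θ' x, θ x ≠ θ' x → e x ∈ symmDiff (S θ) (S θ') := by
    intro θ θ' x h
    rw [Finset.mem_symmDiff, hmem, hmem]
    omega
  refine ⟨fun θ => flatCoef γ (S θ), fun θ => ?_, fun θ i k => ?_, fun p hp θ θ' h => ?_⟩
  · refine (numGroups_flatCoef_le γ (S θ)).trans ?_
    have hsub : (S θ).image Prod.fst ⊆ Finset.univ.image (Fin.castLE hsM) := by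
      intro j hj
      simp only [S, Finset.mem_image, Finset.mem_map, Finset.mem_filter] at hj
      obtain ⟨_, ⟨x, -, rfl⟩, rfl⟩ := hj
      exact Finset.mem_image_of_mem _ (Finset.mem_univ x.1)
    refine (Finset.card_le_card hsub).trans (Finset.card_image_le.trans ?_)
    simp
  · rw [norm_flatCoef_sub_sq]
    refine mul_le_mul_of_nonneg_right ?_ (sq_nonneg γ)
    have hsub : symmDiff (S (Function.update θ i k)) (S θ) ⊆ {e i} := by
      intro y hy
      have hy' : ∃ x, e x = y := by
        rcases Finset.mem_symmDiff.1 hy with h | h <;>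
        · obtain ⟨x, -, rfl⟩ := Finset.mem_map.1 h.1
          exact ⟨x, rfl⟩
      obtain ⟨x, rfl⟩ := hy'
      rw [Finset.mem_singleton]
      by_contra hne
      have hxi : x ≠ i := fun h => hne (h ▸ rfl)
      rw [Finset.mem_symmDiff, hmem, hmem, Function.update_of_ne hxi] at hy
      tauto
    have := Finset.card_le_card hsub
    rw [Finset.card_singleton] at this
    exact_mod_cast this.trans one_le_two
  · set N : Fin s → Finset (Fin T) := fun j => Finset.univ.filter fun t => θ (j, t) ≠ θ' (j, t)
    have hsumN : hammingDist θ θ' = ∑ j, (N j).card := by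
      simp_rw [hammingDist, N, Finset.card_filter, Fintype.sum_prod_type]
    set J : Finset (Fin s) := Finset.univ.filter fun j => T ≤ 20 * (N j).card
    rcases Nat.eq_zero_or_pos T with hT | hT
    · have h0 : √((T : ℝ) / 20) = 0 := by simp [hT]
      rw [h0, mul_zero, mul_zero, zero_div]
      exact mixedNorm_nonneg hp _
    -- At least `T s / 10` errors, at most `T` in each group: a twentieth of the groups
    -- has `T / 20` errors.
    have hJ : s ≤ 20 * J.card := by
      have h1 : ∀ j, 20 * (N j).card ≤ 20 * T * (if j ∈ J then 1 else 0) + T := by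
        intro j
        have hNT : (N j).card ≤ T := by simpa using Finset.card_le_univ (N j)
        by_cases hj : j ∈ J
        · rw [if_pos hj]; omega
        · rw [if_neg hj]
          simp only [J, Finset.mem_filter, Finset.mem_univ, true_and, not_le] at hj
          omega
      have h2 := Finset.sum_le_sum fun j (_ : j ∈ Finset.univ) => h1 j
      rw [← Finset.mul_sum, ← hsumN, Finset.sum_add_distrib, ← Finset.mul_sum] at h2
      simp only [Finset.sum_boole, Finset.filter_univ_mem, Nat.cast_id, Finset.sum_const,
        Finset.card_univ, Fintype.card_fin, smul_eq_mul] at h2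
      rw [Fintype.card_prod, Fintype.card_fin, Fintype.card_fin] at h
      refine Nat.le_of_mul_le_mul_right ?_ hT
      nlinarith
    refine le_mixedNorm hp hs _ (J.map (Fin.castLEEmb hsM)) (by simpa using hJ) (by positivity) ?_
    intro j' hj'
    obtain ⟨j, hj, rfl⟩ := Finset.mem_map.1 hj'
    refine le_trans ?_ (le_norm_group_flatCoef_sub γ _ _ _ (N j) fun t ht => ?_)
    · refine mul_le_mul_of_nonneg_left (Real.sqrt_le_sqrt ?_) hγ
      rw [div_le_iff₀ (by norm_num)]
      have : T ≤ 20 * (N j).card := (Finset.mem_filter.1 hj).2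
      exact_mod_cast this.trans_eq (mul_comm _ _)
    · exact hdiff θ θ' (j, t) (Finset.mem_filter.1 ht).2

/-- The family of vectors with a single nonzero task and one entry `γ` in each of `s` disjoint
blocks of `m` variables. -/
theorem exists_sparse_family {s m : ℕ} (hs : 1 ≤ s) (hT : 1 ≤ T) (hsM : s * m ≤ M) {γ : ℝ}
    (hγ : 0 ≤ γ) :
    ∃ B : (Fin s → Fin m) → Coef M T,
      (∀ θ, B θ ∈ GS s M T) ∧
      (∀ θ i k, ‖B (Function.update θ i k) - B θ‖ ^ 2 ≤ 2 * γ ^ 2) ∧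
      ∀ p : ℝ≥0∞, 1 ≤ p → ∀ θ θ', Fintype.card (Fin s) ≤ 10 * hammingDist θ θ' →
        (s : ℝ) ^ (p⁻¹).toReal * γ / 20 ≤ mixedNorm p (B θ - B θ') := by
  classical
  set e : Fin s × Fin m ↪ Fin M := finProdFinEquiv.toEmbedding.trans (Fin.castLEEmb hsM)
  set t₀ : Fin T := ⟨0, hT⟩
  set S : (Fin s → Fin m) → Finset (Fin M × Fin T) :=
    fun θ => Finset.univ.image fun i => (e (i, θ i), t₀)
  have hmem : ∀ θ i k, (e (i, k), t₀) ∈ S θ ↔ θ i = k := by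
    intro θ i k
    simp only [S, Finset.mem_image, Finset.mem_univ, true_and, Prod.mk.injEq, and_true,
      e.injective.eq_iff]
    constructor
    · rintro ⟨_, rfl, rfl⟩; rfl
    · rintro rfl; exact ⟨i, rfl, rfl⟩
  refine ⟨fun θ => flatCoef γ (S θ), fun θ => ?_, fun θ i k => ?_, fun p hp θ θ' h => ?_⟩
  · refine (numGroups_flatCoef_le γ (S θ)).trans
      (Finset.card_image_le.trans (Finset.card_image_le.trans ?_))
    simp
  · rw [norm_flatCoef_sub_sq]
    refine mul_le_mul_of_nonneg_right ?_ (sq_nonneg γ)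
    have hsub : symmDiff (S (Function.update θ i k)) (S θ)
        ⊆ {(e (i, k), t₀), (e (i, θ i), t₀)} := by
      intro y hy
      obtain ⟨i', k', rfl⟩ : ∃ i' k', (e (i', k'), t₀) = y := by
        rcases Finset.mem_symmDiff.1 hy with h | h <;>
        · obtain ⟨i', -, rfl⟩ := Finset.mem_image.1 h.1
          exact ⟨i', _, rfl⟩
      rw [Finset.mem_symmDiff, hmem, hmem] at hy
      rw [Finset.mem_insert, Finset.mem_singleton]
      by_cases hi : i' = i
      · subst hi
        rw [Function.update_self] at hy
        rcases hy with ⟨rfl, -⟩ | ⟨rfl, -⟩ <;> simp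
      · rw [Function.update_of_ne hi] at hy
        tauto
    exact_mod_cast (Finset.card_le_card hsub).trans Finset.card_le_two
  · set I : Finset (Fin s) := Finset.univ.filter fun i => θ i ≠ θ' i
    have hinj : Function.Injective fun i => e (i, θ i) := fun i i' h =>
      (Prod.mk.inj (e.injective h)).1
    refine le_mixedNorm hp hs _ (I.image fun i => e (i, θ i)) ?_ hγ ?_
    · rw [Finset.card_image_of_injective _ hinj]
      have : hammingDist θ θ' = I.card := rfl
      rw [Fintype.card_fin] at h
      omega
    · intro j hj
      obtain ⟨i, hi, rfl⟩ := Finset.mem_image.1 hj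
      have hne : θ' i ≠ θ i := (Finset.mem_filter.1 hi).2.symm
      have h1 := le_norm_group_flatCoef_sub γ (S θ) (S θ') (e (i, θ i)) {t₀} fun t ht => by
        rw [Finset.mem_singleton.1 ht, Finset.mem_symmDiff, hmem, hmem]
        exact Or.inl ⟨rfl, hne⟩
      simpa using h1

end Hypotheses



/-! ### Calibration to the minimax rate -/

section Calibration

variable {n M T s : ℕ} {σ κ₂ : ℝ}

theorem rate_pos (hn : 1 ≤ n) (hs : 1 ≤ s) (hsM : s ≤ M) (hσ : 0 < σ) (hκ : 0 < κ₂) (p : ℝ≥0∞) :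
    0 < rate n M T s σ κ₂ p := by
  have hn' : (0 : ℝ) < n := by exact_mod_cast hn
  have hs' : (0 : ℝ) < s := by exact_mod_cast hs
  have hM' : (s : ℝ) ≤ M := by exact_mod_cast hsM
  have hL : 0 ≤ Real.log (Real.exp 1 * M / s) := by
    apply Real.log_nonneg
    rw [le_div_iff₀ hs', one_mul]
    nlinarith [Real.add_one_le_exp (1 : ℝ)]
  unfold rate
  positivity

/-- Comparison of the rate with the separation of the two families: `h` is the size of the error of
a wrong group in units of `σ / (κ₂ √n)`. -/
theorem sqrt_mul_rate_le (hT : 1 ≤ T) (hσ : 0 < σ) (hκ : 0 < κ₂) (p : ℝ≥0∞) {h : ℝ}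
    (hh : √(T + Real.log (Real.exp 1 * M / s)) ≤ 50 * h) :
    √(T : ℝ) * rate n M T s σ κ₂ p / 1000
      ≤ (s : ℝ) ^ (p⁻¹).toReal * (σ / κ₂ / √(n : ℝ) * h) / 20 := by
  have hT' : (0 : ℝ) < T := by exact_mod_cast hT
  have h1 : √(T : ℝ) * √(1 + Real.log (Real.exp 1 * M / s) / T)
      = √(T + Real.log (Real.exp 1 * M / s)) := by
    rw [← Real.sqrt_mul hT'.le, mul_add, mul_div_cancel₀ _ hT'.ne', mul_one]
  have h2 : √(T : ℝ) * rate n M T s σ κ₂ p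
      = (s : ℝ) ^ (p⁻¹).toReal * (σ / κ₂ / √(n : ℝ)) * √(T + Real.log (Real.exp 1 * M / s)) := by
    rw [← h1, rate]; ring
  rw [h2]
  have h3 := mul_le_mul_of_nonneg_left hh
    (by positivity : 0 ≤ (s : ℝ) ^ (p⁻¹).toReal * (σ / κ₂ / √(n : ℝ)))
  linarith

/-- With `γ = (σ/κ₂) √(log m) / (2√n)`, the predictions of neighbours are `σ √(log m / 2)`-close. -/
theorem UpperRE.norm_predict_sub_sq_le_log {X : Fin T → Matrix (Fin n) (Fin M) ℝ}
    (h : UpperRE X s κ₂) (hn : 1 ≤ n) (hκ : 0 < κ₂) {m : ℕ} {a b : Coef M T} (ha : a ∈ GS s M T)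
    (hb : b ∈ GS s M T)
    (hab : ‖a - b‖ ^ 2 ≤ 2 * (σ / κ₂ / √(n : ℝ) * (√(Real.log m) / 2)) ^ 2) :
    ‖predict X a - predict X b‖ ^ 2 ≤ σ ^ 2 * Real.log m / 2 := by
  have hn' : (0 : ℝ) < n := by exact_mod_cast hn
  have hlog : 0 ≤ Real.log m := Real.log_natCast_nonneg m
  refine (h.norm_predict_sub_sq_le hn ha hb).trans ?_
  calc κ₂ ^ 2 * (n * ‖a - b‖ ^ 2)
      ≤ κ₂ ^ 2 * (n * (2 * (σ / κ₂ / √(n : ℝ) * (√(Real.log m) / 2)) ^ 2)) := by gcongr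
    _ = σ ^ 2 * Real.log m / 2 := by
        rw [mul_pow, div_pow, div_pow, div_pow, Real.sq_sqrt hn'.le, Real.sq_sqrt hlog]
        field_simp

/-- For `m = ⌊M / s⌋ ≥ 2`, `log (e M / s) ≤ 4 log m`, since `e (m + 1) ≤ m ^ 4`. -/
theorem log_exp_mul_div_le (hs : 1 ≤ s) (hsM : 2 * s ≤ M) :
    Real.log (Real.exp 1 * M / s) ≤ 4 * Real.log (M / s : ℕ) := by
  have hs' : (0 : ℝ) < s := by exact_mod_cast hs
  have hM' : (0 : ℝ) < M := by exact_mod_cast (show 0 < M by omega)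
  set m := M / s
  have hm : 2 ≤ m := (Nat.le_div_iff_mul_le hs).2 hsM
  have hm' : (2 : ℝ) ≤ m := by exact_mod_cast hm
  have h1 : (M : ℝ) / s ≤ m + 1 := by
    rw [div_le_iff₀ hs']
    exact_mod_cast (Nat.lt_mul_of_div_lt (Nat.lt_succ_self m) hs).le
  have h2 : Real.exp 1 * M / s ≤ (m : ℝ) ^ 4 := by
    have he : Real.exp 1 ≤ 3 := by linarith [Real.exp_one_lt_d9]
    calc Real.exp 1 * M / s = Real.exp 1 * (M / s) := by ring
      _ ≤ 3 * (m + 1) := by gcongr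
      _ ≤ (m : ℝ) ^ 4 := by
        nlinarith [mul_nonneg (sub_nonneg.2 hm') (sub_nonneg.2 hm'), sq_nonneg ((m : ℝ) ^ 2 - 4)]
  calc Real.log (Real.exp 1 * M / s) ≤ Real.log ((m : ℝ) ^ 4) :=
        Real.log_le_log (by positivity) h2
    _ = 4 * Real.log m := by rw [Real.log_pow]; norm_num

/-- The least favourable parameters. If `T` dominates `log (e M / s)`, the values on a fixed set of
`s` groups are unknown; otherwise the positions of the `s` nonzero groups are unknown. -/
theorem exists_hypotheses (hn : 1 ≤ n) (hT : 1 ≤ T) (hs : 1 ≤ s) (hsM : 2 * s ≤ M)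
    (hσ : 0 < σ) (hκ : 0 < κ₂) :
    ∃ (ι : Type) (_ : Fintype ι) (_ : DecidableEq ι) (_ : Nonempty ι) (m : ℕ)
      (B : (ι → Fin m) → Coef M T), 2 ≤ m ∧ (∀ θ, B θ ∈ GS s M T) ∧
      (∀ X : Fin T → Matrix (Fin n) (Fin M) ℝ, UpperRE X s κ₂ → ∀ θ i k,
        ‖predict X (B (Function.update θ i k)) - predict X (B θ)‖ ^ 2
          ≤ σ ^ 2 * Real.log m / 2) ∧
      ∀ p : ℝ≥0∞, 1 ≤ p → ∀ θ θ', Fintype.card ι ≤ 10 * hammingDist θ θ' →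
        √(T : ℝ) * rate n M T s σ κ₂ p / 1000 ≤ mixedNorm p (B θ - B θ') := by
  have hT' : (0 : ℝ) < T := by exact_mod_cast hT
  have : Nonempty (Fin s) := ⟨⟨0, hs⟩⟩
  have : Nonempty (Fin T) := ⟨⟨0, hT⟩⟩
  rcases le_total (Real.log (Real.exp 1 * M / s)) T with hL | hL
  · obtain ⟨B, hB, hstep, hsep⟩ := exists_dense_family (T := T) hs (show s ≤ M by omega)
      (γ := σ / κ₂ / √(n : ℝ) * (√(Real.log (2 : ℕ)) / 2)) (by positivity)
    refine ⟨Fin s × Fin T, inferInstance, inferInstance, inferInstance, 2, B, le_rfl, hB,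
      fun X hX θ i k => hX.norm_predict_sub_sq_le_log hn hκ (hB _) (hB _) (hstep θ i k),
      fun p hp θ θ' h => ?_⟩
    refine le_trans ?_ (hsep p hp θ θ' h)
    rw [mul_assoc (σ / κ₂ / _)]
    refine sqrt_mul_rate_le hT hσ hκ p ?_
    have hlog2 : (1 / 2 : ℝ) ≤ Real.log (2 : ℕ) := by
      have := Real.log_two_gt_d9
      push_cast; linarith
    refine Real.sqrt_le_iff.2 ⟨by positivity, ?_⟩
    rw [mul_pow, mul_pow, div_pow, Real.sq_sqrt (Real.log_natCast_nonneg 2),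
      Real.sq_sqrt (by positivity)]
    nlinarith [mul_le_mul_of_nonneg_right hlog2 hT'.le]
  · obtain ⟨B, hB, hstep, hsep⟩ := exists_sparse_family hs hT (Nat.mul_div_le M s)
      (γ := σ / κ₂ / √(n : ℝ) * (√(Real.log (M / s : ℕ)) / 2)) (by positivity)
    refine ⟨Fin s, inferInstance, inferInstance, inferInstance, M / s, B,
      (Nat.le_div_iff_mul_le hs).2 hsM, hB,
      fun X hX θ i k => hX.norm_predict_sub_sq_le_log hn hκ (hB _) (hB _) (hstep θ i k),
      fun p hp θ θ' h => ?_⟩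
    refine le_trans ?_ (hsep p hp θ θ' h)
    refine sqrt_mul_rate_le hT hσ hκ p ?_
    have h4 := log_exp_mul_div_le hs hsM
    have hlog : 0 ≤ Real.log (M / s : ℕ) := Real.log_natCast_nonneg _
    refine Real.sqrt_le_iff.2 ⟨by positivity, ?_⟩
    rw [mul_pow, div_pow, Real.sq_sqrt hlog]
    linarith

end Calibration

end MultiTask

theorem theorem6p1 (ℓ : ℝ≥0 → ℝ≥0) (hℓ_mono : Monotone ℓ) (hℓ_zero : ℓ 0 = 0)
    (hℓ_ne : ∃ u, ℓ u ≠ 0) :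
    (∀ p : ℝ≥0∞, 1 ≤ p →
      ∃ b c : ℝ, 0 < b ∧ 0 < c ∧
        ∀ (n M T s : ℕ), 1 ≤ n → 2 ≤ M → 1 ≤ T → 1 ≤ s → 2 * s ≤ M →
        ∀ (X : Fin T → Matrix (Fin n) (Fin M) ℝ) (σ κ₂ : ℝ), 0 < σ → 0 < κ₂ →
          MultiTask.UpperRE X s κ₂ →
        ∀ (Ω : Type*) [MeasurableSpace Ω] (P : Measure Ω) [IsProbabilityMeasure P]
          (W : Fin n × Fin T → Ω → ℝ), MultiTask.IsGaussianNoise P W σ →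
          ENNReal.ofReal c ≤ MultiTask.minimaxRisk P X W s ℓ (fun τ β =>
            b * (MultiTask.rate n M T s σ κ₂ p)⁻¹ *
              (1 / √(T : ℝ) * MultiTask.mixedNorm p (τ - β)))) ∧
    (∃ b c : ℝ, 0 < b ∧ 0 < c ∧
      ∀ (n M T s : ℕ), 1 ≤ n → 2 ≤ M → 1 ≤ T → 1 ≤ s → 2 * s ≤ M →
      ∀ (X : Fin T → Matrix (Fin n) (Fin M) ℝ) (σ κ₁ κ₂ : ℝ), 0 < σ → 0 < κ₁ → 0 < κ₂ →
        MultiTask.LowerRE X s κ₁ → MultiTask.UpperRE X s κ₂ →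
      ∀ (Ω : Type*) [MeasurableSpace Ω] (P : Measure Ω) [IsProbabilityMeasure P]
        (W : Fin n × Fin T → Ω → ℝ), MultiTask.IsGaussianNoise P W σ →
        ENNReal.ofReal c ≤ MultiTask.minimaxRisk P X W s ℓ (fun τ β =>
          b * (MultiTask.rate n M T s σ κ₂ 2)⁻¹ *
            (1 / (κ₁ * √((n : ℝ) * (T : ℝ))) * ‖MultiTask.predict X (τ - β)‖))) := by
  obtain ⟨u, hu⟩ := hℓ_ne
  have hu0 : (0 : ℝ) < u := by
    have : u ≠ 0 := fun h => hu (h ▸ hℓ_zero)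
    exact_mod_cast pos_iff_ne_zero.2 this
  have hℓu : (0 : ℝ) < ℓ u := by exact_mod_cast pos_iff_ne_zero.2 hu
  -- Parameters are `√T · rate / 1000` apart; `2000` includes a factor `2` from the triangle
  -- inequality, so that the argument of `ℓ` reaches `u`.
  refine ⟨fun p hp => ⟨2000 * u, ℓ u / 20, by positivity, by positivity, ?_⟩,
    2000 * u, ℓ u / 20, by positivity, by positivity, ?_⟩
  · intro n M T s hn _ hT hs hsM X σ κ₂ hσ hκ₂ hX Ω _ P _ W hW
    have := Fact.mk hp
    have hT' : (0 : ℝ) < T := by exact_mod_cast hT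
    have hrate := MultiTask.rate_pos (T := T) hn hs (show s ≤ M by omega) hσ hκ₂ p
    obtain ⟨ι, _, _, _, m, B, hm, hB, hstep, hsep⟩ :=
      MultiTask.exists_hypotheses hn hT hs hsM hσ hκ₂
    have h := MultiTask.le_minimaxRisk_norm X hW hσ hℓ_mono (MultiTask.groupₗ M T p)
      (c := 2000 * u * (MultiTask.rate n M T s σ κ₂ p)⁻¹ * (1 / √(T : ℝ))) (by positivity)
      hm hB (hstep X hX) (u := u) fun θ θ' hθ => by
        rw [MultiTask.norm_groupₗ]
        refine le_trans (le_of_eq ?_) (mul_le_mul_of_nonneg_left (hsep p hp θ θ' hθ)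
          (by positivity))
        field_simp
        norm_num
    simpa only [MultiTask.norm_groupₗ, mul_assoc] using h
  · intro n M T s hn _ hT hs hsM X σ κ₁ κ₂ hσ hκ₁ hκ₂ hX₁ hX Ω _ P _ W hW
    have hT' : (0 : ℝ) < T := by exact_mod_cast hT
    have hn' : (0 : ℝ) < n := by exact_mod_cast hn
    have hrate := MultiTask.rate_pos (T := T) hn hs (show s ≤ M by omega) hσ hκ₂ 2
    obtain ⟨ι, _, _, _, m, B, hm, hB, hstep, hsep⟩ :=
      MultiTask.exists_hypotheses hn hT hs hsM hσ hκ₂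
    have h := MultiTask.le_minimaxRisk_norm X hW hσ hℓ_mono (MultiTask.predictₗ X)
      (c := 2000 * u * (MultiTask.rate n M T s σ κ₂ 2)⁻¹ * (1 / (κ₁ * √((n : ℝ) * (T : ℝ)))))
      (by positivity) hm hB (hstep X hX) (u := u) fun θ θ' hθ => by
        have h1 := hsep 2 one_le_two θ θ' hθ
        rw [MultiTask.mixedNorm_two] at h1
        have h2 := (mul_le_mul_of_nonneg_left h1 (by positivity : 0 ≤ κ₁ * √(n : ℝ))).trans
          (hX₁.le_norm_predict_sub hn (hB θ) (hB θ'))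
        refine le_trans (le_of_eq ?_) (mul_le_mul_of_nonneg_left h2 (by positivity))
        rw [Real.sqrt_mul hn'.le]
        field_simp
        norm_num
    simpa only [MultiTask.predictₗ_apply, mul_assoc] using h
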